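/- Let $(\mathbb{F},\mathbb{A})$ be $(\mathbb{R},\mathbb{H})$ or $(\mathbb{C},\mathbb{O})$, where $\mathbb{H}\subset\mathbb{O}$ are the real quaternions and the real octonions $u+\mathbf{k}v$ ($u,v\in\mathbb{H}$), with $(\mathbf{k}u)v=\mathbf{k}(vu)=\bar v(\mathbf{k}u)$, $(\mathbf{k}u)(\mathbf{k}v)=-v\bar u$, conjugation $\overline{u+\mathbf{k}v}=\bar u-\mathbf{k}v$ and $|u+\mathbf{k}v|^2=|u|^2+|v|^2$. View $\mathbb{A}$ and $\mathbb{O}$ as $\mathbb{F}$-vector spaces by right multiplication, let $(x|y)$ be the $\mathbb{F}$-part (the real, respectively complex, part) of $\bar x y$, let $\perp$ be the corresponding orthogonality relation, and let $\mathrm{Pu}_\mathbb{F}$ be the subspace of the elements whose $\mathbb{F}$-part is $0$. The geometry $\Gamma=\Gamma_\mathbb{F}(\mathbb{A})$ has the following elements. The points are the one-dimensional subspaces $[y]$ of $\mathrm{Pu}_\mathbb{F}(\mathbb{A})$. The lines are the sets $[x,u]=\{(xt,ut)\mid t\in\mathbb{F}\setminus\{0\}\}$ with $x\in\mathrm{Pu}_\mathbb{F}(\mathbb{A})$,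 $u\in\mathrm{Pu}_\mathbb{F}(\mathbb{O})$ and $|x|=|u|\neq 0$. The planes are the $\mathbb{F}$-linear multiplicative maps $\phi:\mathbb{A}\to\mathbb{O}$ that preserve $(\cdot|\cdot)$. Every point is incident with every plane; $[y]$ is incident with $[x,u]$ when $x\perp y$; $[x,u]$ is incident with $\phi$ when $\phi(x)=u$. Two lines are coplanar when some plane is incident with both. A primitive path is a closed path $\alpha=(p,L,q,M,p)$ with $p,q$ points and $L,M$ lines, each incident with both points. It is degenerate if $p=q$ or $L=M$, and orthogonal if $p\perp q$. If $p\neq q$, one can write $L=[a,u]$ and $M=[a,v]$ with the same $a$, and the line-invariant of $\alpha$ is $\ell(\alpha)=(u|v)/(|u||v|)$, which does not depend on the choice of $a$. Let $\alpha$ be non-degenerate. A line $N$ is admissible for $\alpha$ if $q$ is on $N$ and $N$ is coplanar with $L$ and coplanar with $M$. For such an $N$ and a point $r$ of $N$, a shift of $\alpha$ from $q$ to $r$ along $N$ is a primitive path $(p,L',r,M',p)$ such that $L'$ is a line of a plane on $N$ and $L$, and $M'$ is a line of a plane on $N$ and $M$. It is an orthogonal shift along $N$ if $p\perp r$; when there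 is exactly one orthogonal shift of $\alpha$ along $N$, it is denoted by $\sigma^N_\perp(\alpha)$. **Lemma.** Let $\alpha$ be a non-orthogonal, non-degenerate primitive path of $\Gamma_\mathbb{F}(\mathbb{A})$. Then there is a line $N$ admissible for $\alpha$ such that $\alpha$ has exactly one orthogonal shift $\sigma^N_\perp(\alpha)$ along $N$, and its line-invariant satisfies $\ell(\sigma^N_\perp(\alpha))\neq -1$. -/

import Mathlib

open scoped Quaternion

namespace OP2

/-! ### The real octonions -/

/-- The real octonions `u + 𝐤 v` with `u v : ℍ`; `fst` is `u` and `snd` is `v`. -/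
@[ext]
structure Octonion where
  fst : ℍ[ℝ]
  snd : ℍ[ℝ]

namespace Octonion

noncomputable instance : Zero Octonion := ⟨⟨0, 0⟩⟩
noncomputable instance : One Octonion := ⟨⟨1, 0⟩⟩
noncomputable instance : Add Octonion := ⟨fun x y => ⟨x.fst + y.fst, x.snd + y.snd⟩⟩
noncomputable instance : Neg Octonion := ⟨fun x => ⟨-x.fst, -x.snd⟩⟩

/-- The product determined by `(𝐤u)v = 𝐤(vu) = v̄(𝐤u)` and `(𝐤u)(𝐤v) = -vū`. -/
noncomputable instance : Mul Octonion :=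
  ⟨fun x y => ⟨x.fst * y.fst - y.snd * star x.snd, star x.fst * y.snd + y.fst * x.snd⟩⟩

/-- The conjugation `u + 𝐤v ↦ ū - 𝐤v`. -/
noncomputable instance : Star Octonion := ⟨fun x => ⟨star x.fst, -x.snd⟩⟩

/-- The norm `|u + 𝐤v| = √(|u|² + |v|²)`. -/
noncomputable instance : Norm Octonion := ⟨fun x => Real.sqrt (‖x.fst‖ ^ 2 + ‖x.snd‖ ^ 2)⟩

@[simp] theorem zero_fst : (0 : Octonion).fst = 0 := rfl
@[simp] theorem zero_snd : (0 : Octonion).snd = 0 := rfl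
@[simp] theorem one_fst : (1 : Octonion).fst = 1 := rfl
@[simp] theorem one_snd : (1 : Octonion).snd = 0 := rfl
@[simp] theorem add_fst (x y : Octonion) : (x + y).fst = x.fst + y.fst := rfl
@[simp] theorem add_snd (x y : Octonion) : (x + y).snd = x.snd + y.snd := rfl
@[simp] theorem neg_fst (x : Octonion) : (-x).fst = -x.fst := rfl
@[simp] theorem neg_snd (x : Octonion) : (-x).snd = -x.snd := rfl
@[simp] theorem mul_fst (x y : Octonion) :
    (x * y).fst = x.fst * y.fst - y.snd * star x.snd := rfl
@[simp] theorem mul_snd (x y : Octonion) :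
    (x * y).snd = star x.fst * y.snd + y.fst * x.snd := rfl
@[simp] theorem star_fst (x : Octonion) : (star x).fst = star x.fst := rfl
@[simp] theorem star_snd (x : Octonion) : (star x).snd = -x.snd := rfl
theorem norm_def (x : Octonion) : ‖x‖ = Real.sqrt (‖x.fst‖ ^ 2 + ‖x.snd‖ ^ 2) := rfl

noncomputable instance : AddCommGroup Octonion where
  add_assoc x y z := by ext1 <;> simp only [add_fst, add_snd, add_assoc]
  zero_add x := by ext1 <;> simp only [add_fst, add_snd, zero_fst, zero_snd, zero_add]
  add_zero x := by ext1 <;> simp only [add_fst, add_snd, zero_fst, zero_snd, add_zero]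
  neg_add_cancel x := by
    ext1 <;> simp only [add_fst, add_snd, neg_fst, neg_snd, zero_fst, zero_snd, neg_add_cancel]
  add_comm x y := by
    ext1
    · exact add_comm x.fst y.fst
    · exact add_comm x.snd y.snd
  nsmul := nsmulRec
  zsmul := zsmulRec

noncomputable instance : NonAssocRing Octonion where
  left_distrib x y z := by ext1 <;> simp [mul_add, add_mul] <;> abel
  right_distrib x y z := by ext1 <;> simp [mul_add, add_mul] <;> abel
  zero_mul x := by ext1 <;> simp
  mul_zero x := by ext1 <;> simp
  one_mul x := by ext1 <;> simp
  mul_one x := by ext1 <;> simp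

/-- The inclusion `ℂ ⊆ ℍ ⊆ 𝕆`. -/
noncomputable def ofComplex (c : ℂ) : Octonion := ⟨(c : ℍ[ℝ]), 0⟩

/-- The complex scalar multiplication on the octonions is the product of octonions with the
complex scalar on the right. -/
noncomputable instance : SMul ℂ Octonion := ⟨fun c x => x * ofComplex c⟩

theorem complex_smul_def (c : ℂ) (x : Octonion) : c • x = x * ofComplex c := rfl

@[simp] theorem complex_smul_fst (c : ℂ) (x : Octonion) :
    (c • x).fst = x.fst * (c : ℍ[ℝ]) := by
  simp [complex_smul_def, ofComplex]

@[simp] theorem complex_smul_snd (c : ℂ) (x : Octonion) :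
    (c • x).snd = (c : ℍ[ℝ]) * x.snd := by
  simp [complex_smul_def, ofComplex]

/-- The octonions as a (right) vector space over `ℂ`. The real vector space structure is the one
obtained by restricting scalars. -/
noncomputable instance : Module ℂ Octonion where
  one_smul x := by ext1 <;> simp
  mul_smul a b x := by
    ext1
    · rw [mul_comm a b]; simp [mul_assoc]
    · simp [mul_assoc]
  smul_zero a := by ext1 <;> simp
  smul_add a x y := by ext1 <;> simp [mul_add, add_mul]
  add_smul a b x := by ext1 <;> simp [mul_add, add_mul]
  zero_smul x := by ext1 <;> simp

@[simp] theorem real_smul_fst (r : ℝ) (x : Octonion) : (r • x).fst = r • x.fst := by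
  have h : r • x = (r : ℂ) • x := rfl
  rw [h, complex_smul_fst]
  ext <;> simp [mul_comm]

@[simp] theorem real_smul_snd (r : ℝ) (x : Octonion) : (r • x).snd = r • x.snd := by
  have h : r • x = (r : ℂ) • x := rfl
  rw [h, complex_smul_snd]
  ext <;> simp

theorem norm_sq (x : Octonion) : ‖x‖ ^ 2 = ‖x.fst‖ ^ 2 + ‖x.snd‖ ^ 2 := by
  rw [norm_def, Real.sq_sqrt (by positivity)]

end Octonion

/-! ### `𝔽`-parts, the form `(·|·)_𝔽` and `𝔽`-pure elements -/

/-- The `𝔽`-part of the elements of `𝔸`, where `𝔽` is `ℝ` or `ℂ`. This is only used through the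
three instances below; the two laws, proved there, give that `(L|M)` is well defined. -/
class HasFPart (F A : Type) [RCLike F] [NonAssocRing A] [Star A] [Norm A] [Module F A] where
  fPart : A →ₗ[F] F
  fPart_star_smul : ∀ (t : F) (x y : A),
    fPart (star (t • x) * (t • y)) = ((‖t‖ ^ 2 : ℝ) : F) * fPart (star x * y)
  norm_smul' : ∀ (t : F) (x : A), ‖t • x‖ = ‖t‖ * ‖x‖

/-- The real part of a quaternion. -/
noncomputable instance : HasFPart ℝ ℍ[ℝ] where
  fPart := { toFun := fun x => x.re, map_add' := by simp, map_smul' := by simp }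
  fPart_star_smul t x y := by simp; ring
  norm_smul' t x := norm_smul t x

/-- The real part of an octonion. -/
noncomputable instance : HasFPart ℝ Octonion where
  fPart := { toFun := fun x => x.fst.re, map_add' := by simp, map_smul' := by simp }
  fPart_star_smul t x y := by
    change (star (t • x) * t • y).fst.re = ‖t‖ ^ 2 * (star x * y).fst.re
    simp; ring
  norm_smul' t x := by
    refine (sq_eq_sq₀ (Real.sqrt_nonneg _)
      (mul_nonneg (norm_nonneg t) (Real.sqrt_nonneg _))).1 ?_
    change ‖t • x‖ ^ 2 = (‖t‖ * ‖x‖) ^ 2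
    rw [mul_pow, Octonion.norm_sq, Octonion.norm_sq]
    simp only [Octonion.real_smul_fst, Octonion.real_smul_snd, norm_smul]
    ring

/-- The complex part of an octonion. -/
noncomputable instance : HasFPart ℂ Octonion where
  fPart :=
    { toFun := fun x => ⟨x.fst.re, x.fst.imI⟩
      map_add' := fun x y => by apply Complex.ext <;> simp
      map_smul' := fun c x => by apply Complex.ext <;> simp <;> ring }
  fPart_star_smul t x y := by
    have h : ‖t‖ ^ 2 = t.re ^ 2 + t.im ^ 2 := by
      rw [Complex.sq_norm, Complex.normSq_apply]; ring
    rw [h]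
    apply Complex.ext <;> simp [pow_two] <;> ring
  norm_smul' t x := by
    refine (sq_eq_sq₀ (Real.sqrt_nonneg _)
      (mul_nonneg (norm_nonneg t) (Real.sqrt_nonneg _))).1 ?_
    change ‖t • x‖ ^ 2 = (‖t‖ * ‖x‖) ^ 2
    rw [mul_pow, Octonion.norm_sq, Octonion.norm_sq]
    simp only [Octonion.complex_smul_fst, Octonion.complex_smul_snd, norm_mul]
    have h : ‖(t : ℍ[ℝ])‖ ^ 2 = ‖t‖ ^ 2 := by
      rw [pow_two, ← Quaternion.normSq_eq_norm_mul_self, Quaternion.normSq_def',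
        Complex.sq_norm, Complex.normSq_apply]
      simp; ring
    rw [mul_pow, mul_pow, h]
    ring

section Generic

variable (F A : Type) [RCLike F] [NonAssocRing A] [Star A] [Norm A] [Module F A] [HasFPart F A]

/-- The inner product `(x|y)_𝔽`, the `𝔽`-part of `x̄y`. -/
noncomputable def form (x y : A) : F := HasFPart.fPart (F := F) (star x * y)

/-- The space `Pu_𝔽(𝔸)` of `𝔽`-pure elements, those whose `𝔽`-part vanishes
(equivalently, those orthogonal to `𝔽` for the form `Re(x̄y)`). -/
noncomputable def Pu : Submodule F A := LinearMap.ker (HasFPart.fPart (F := F) (A := A))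

end Generic

theorem form_real_quaternion (x y : ℍ[ℝ]) : form ℝ ℍ[ℝ] x y = (star x * y).re := rfl

theorem form_real_octonion (x y : Octonion) : form ℝ Octonion x y = (star x * y).fst.re := rfl

theorem form_complex_octonion (x y : Octonion) :
    form ℂ Octonion x y = ⟨(star x * y).fst.re, (star x * y).fst.imI⟩ := rfl

theorem mem_Pu_real_quaternion (x : ℍ[ℝ]) : x ∈ Pu ℝ ℍ[ℝ] ↔ x.re = 0 := Iff.rfl

theorem mem_Pu_real_octonion (x : Octonion) : x ∈ Pu ℝ Octonion ↔ x.fst.re = 0 := Iff.rfl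

theorem mem_Pu_complex_octonion (x : Octonion) :
    x ∈ Pu ℂ Octonion ↔ x.fst.re = 0 ∧ x.fst.imI = 0 := Complex.ext_iff

/-! ### The geometry `Γ_𝔽(𝔸)` -/

section Geometry

variable (F A : Type) [RCLike F] [NonAssocRing A] [Star A] [Norm A] [Module F A] [HasFPart F A]
variable [Module F Octonion] [HasFPart F Octonion]

/-- Points: the one-dimensional subspaces of `Pu_𝔽(𝔸)`. -/
abbrev Point : Type := Projectivization F (Pu F A)

/-- The set of pairs `[x,u] = {(xt,ut) | t ∈ 𝔽*}`. -/
def pairClass {F A : Type} [RCLike F] [NonAssocRing A] [Module F A] [Module F Octonion]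
    (x : A) (u : Octonion) : Set (A × Octonion) :=
  {w | ∃ t : F, t ≠ 0 ∧ w = (t • x, t • u)}

/-- Lines: the sets `[x,u]` with `x ∈ Pu_𝔽(𝔸)`, `u ∈ Pu_𝔽(𝕆)` and `|x| = |u| ≠ 0`. -/
@[ext]
structure Line where
  carrier : Set (A × Octonion)
  exists_rep : ∃ x ∈ Pu F A, ∃ u ∈ Pu F Octonion,
    ‖x‖ = ‖u‖ ∧ ‖u‖ ≠ 0 ∧ carrier = pairClass (F := F) x u

/-- Planes: the sharp `𝔽`-morphisms `𝔸 → 𝕆`, that is the `𝔽`-linear maps that preserve the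
product and `(·|·)_𝔽`. -/
structure Plane extends A →ₗ[F] Octonion where
  map_mul' : ∀ x y : A, toFun (x * y) = toFun x * toFun y
  map_form' : ∀ x y : A, form F Octonion (toFun x) (toFun y) = form F A x y

variable {F A}

/-- Orthogonality of points with respect to `(·|·)_𝔽`. -/
def Point.Perp (p q : Point F A) : Prop :=
  ∀ x ∈ p.submodule, ∀ y ∈ q.submodule, form F A x y = 0

/-- The point `[y]` and the line `[x,u]` are incident when `y ∈ x^⊥`. -/
def Point.On (p : Point F A) (L : Line F A) : Prop :=
  ∀ w ∈ L.carrier, ∀ y ∈ p.submodule, form F A w.1 y = 0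

/-- The line `[x,u]` and the plane `φ` are incident when `φ(x) = u`. -/
def Line.On (L : Line F A) (φ : Plane F A) : Prop :=
  ∀ w ∈ L.carrier, φ.toLinearMap w.1 = w.2

/-- Two lines are coplanar when some plane is incident with both. -/
def Line.Coplanar (L M : Line F A) : Prop := ∃ φ : Plane F A, L.On φ ∧ M.On φ

open Classical in
/-- The scalar `(L|M) = (u|v)/(|u||v|)`, where `L = [a,u]` and `M = [a,v]` are represented with
the same first component `a`. Such representations exist when `L` and `M` have the same shadow;
the value `0` is used otherwise. -/
noncomputable def Line.inner (L M : Line F A) : F :=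
  if h : ∃ w : A × Octonion × Octonion, (w.1, w.2.1) ∈ L.carrier ∧ (w.1, w.2.2) ∈ M.carrier then
    form F Octonion h.choose.2.1 h.choose.2.2 /
      ((‖h.choose.2.1‖ * ‖h.choose.2.2‖ : ℝ) : F)
  else 0

/-- `(L|M)` does not depend on the choice of the common first component. -/
theorem Line.inner_eq (L M : Line F A) {a : A} {u v : Octonion}
    (hu : (a, u) ∈ L.carrier) (hv : (a, v) ∈ M.carrier) :
    L.inner M = form F Octonion u v / ((‖u‖ * ‖v‖ : ℝ) : F) := by
  have h : ∃ w : A × Octonion × Octonion,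
      (w.1, w.2.1) ∈ L.carrier ∧ (w.1, w.2.2) ∈ M.carrier := ⟨(a, u, v), hu, hv⟩
  rw [Line.inner, dif_pos h]
  obtain ⟨h1, h2⟩ := h.choose_spec
  generalize h.choose = w at h1 h2 ⊢
  obtain ⟨b, u', v'⟩ := w
  dsimp only at h1 h2 ⊢
  -- all members of a line are proportional by a nonzero scalar
  have key : ∀ (K : Line F A) {y z : A} {s r : Octonion}, (y, s) ∈ K.carrier →
      (z, r) ∈ K.carrier → ‖y‖ ≠ 0 ∧ ∃ t : F, t ≠ 0 ∧ z = t • y ∧ r = t • s := by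
    intro K y z s r hy hz
    obtain ⟨x, -, c, -, hn, hc, hK⟩ := K.exists_rep
    rw [hK] at hy hz
    obtain ⟨t1, ht1, e1⟩ := hy
    obtain ⟨t2, ht2, e2⟩ := hz
    obtain ⟨rfl, rfl⟩ := Prod.mk.inj e1
    obtain ⟨rfl, rfl⟩ := Prod.mk.inj e2
    refine ⟨?_, t2 * t1⁻¹, by positivity, ?_, ?_⟩
    · rw [HasFPart.norm_smul', hn]
      exact mul_ne_zero (norm_ne_zero_iff.2 ht1) hc
    · rw [smul_smul, inv_mul_cancel_right₀ ht1]
    · rw [smul_smul, inv_mul_cancel_right₀ ht1]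
  obtain ⟨ha, t, ht, e1, rfl⟩ := key L hu h1
  obtain ⟨-, t', ht', e2, rfl⟩ := key M hv h2
  have htt : t' = t := by
    by_contra hne
    have h0 : (t' - t) • a = 0 := by rw [sub_smul, ← e1, ← e2, sub_self]
    have ha0 : a = 0 := (smul_eq_zero.1 h0).resolve_left (sub_ne_zero.2 hne)
    apply ha
    have := HasFPart.norm_smul' (0 : F) a
    rwa [zero_smul, norm_zero, zero_mul, ← ha0] at this
  subst htt
  have hn : ((‖t'‖ ^ 2 : ℝ) : F) ≠ 0 := by
    have := norm_ne_zero_iff.2 ht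
    exact_mod_cast pow_ne_zero 2 this
  rw [form, HasFPart.fPart_star_smul, HasFPart.norm_smul', HasFPart.norm_smul', form,
    show ‖t'‖ * ‖u‖ * (‖t'‖ * ‖v‖) = ‖t'‖ ^ 2 * (‖u‖ * ‖v‖) by ring, RCLike.ofReal_mul,
    mul_div_mul_left _ _ hn]

/-! ### Primitive paths and shifts -/

variable (F A)

/-- A primitive path: a closed path `(p, L, q, M, p)` with `p`, `q` points and `L`, `M` lines. -/
@[ext]
structure PrimitivePath where
  p : Point F A
  L : Line F A
  q : Point F A
  M : Line F A
  p_on_L : p.On L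
  q_on_L : q.On L
  q_on_M : q.On M
  p_on_M : p.On M

variable {F A}

namespace PrimitivePath

/-- `α` is degenerate when `p = q` or `L = M`. -/
def Degenerate (α : PrimitivePath F A) : Prop := α.p = α.q ∨ α.L = α.M

/-- `α` is orthogonal when `p ⊥ q`. -/
def Orthogonal (α : PrimitivePath F A) : Prop := α.p.Perp α.q

/-- The line-invariant `ℓ(α) = (L|M)`. -/
noncomputable def lineInvariant (α : PrimitivePath F A) : F := α.L.inner α.M

/-- `N` is admissible for `α = (p,L,q,M,p)` when it is a line on `q` coplanar with each of `L`
and `M`. (Used for non-degenerate `α`.) -/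
def Admissible (α : PrimitivePath F A) (N : Line F A) : Prop :=
  α.q.On N ∧ N.Coplanar α.L ∧ N.Coplanar α.M

/-- `β = (p,L',r,M',p)` is the shift of `α = (p,L,q,M,p)` from `q` to the point `r` of the
admissible line `N`: the line `L'` through `p` and `r` lies in the plane on `N` and `L`, and the
line `M'` through `p` and `r` lies in the plane on `N` and `M`. -/
def IsShift (α : PrimitivePath F A) (N : Line F A) (r : Point F A) (β : PrimitivePath F A) :
    Prop :=
  α.Admissible N ∧ r.On N ∧ β.p = α.p ∧ β.q = r ∧
    (∃ ξ : Plane F A, N.On ξ ∧ α.L.On ξ ∧ β.L.On ξ) ∧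
    (∃ χ : Plane F A, N.On χ ∧ α.M.On χ ∧ β.M.On χ)

/-- `β` is an orthogonal shift of `α` along `N`: a shift to a point `r` of `N` with `p ⊥ r`. -/
def IsOrthogonalShift (α : PrimitivePath F A) (N : Line F A) (β : PrimitivePath F A) : Prop :=
  ∃ r : Point F A, α.IsShift N r β ∧ α.p.Perp r

end PrimitivePath

end Geometry

end OP2

/-!
Within a plane `φ` a line `[x, φ(x)]` is determined by its pole `[x]`, and its points are those
orthogonal to the pole. As `Pu_𝔽(𝔸)` is three-dimensional, two distinct points have exactly one
common perpendicular, so `p ≠ q` forces `L` and `M` to have the same pole `a`.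

Let `b ⊥ a, q` and `c ⊥ a, p`. An orthonormal pair generates the algebra `𝔸`, so morphisms can be
prescribed freely on it. With `L = [a, u]` and `M = [a, v]`, choosing `w ⊥ u, v` in `Pu_𝔽(𝕆)` yields
planes `ξ ∋ L` and `χ ∋ M` sharing the line `N = [b, w]`, and only these planes join `N` to `L` and
to `M`. As `p ≠ b`, an orthogonal shift along `N` ends at the common perpendicular `a` of `p` and
`b`, and its lines are those with pole `c` in `ξ` and `χ`. Were its invariant `-1`, then
`ξ(c) + χ(c) = 0`; pairing this with `ξ(b) = χ(b)` gives `2 (b|c) = 0`, so that `c ⊥ a, b` is `q`,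
whereas `c ⊥ p`.
-/

namespace OP2

open ComplexConjugate

/-- The vector product of two `𝔽`-pure elements: their product without its `𝔽`-part `-(x|y)`. -/
noncomputable def cross (F : Type) {A : Type} [RCLike F] [NonAssocRing A] [Star A] [Norm A]
    [Module F A] [HasFPart F A] (x y : A) : A := x * y + form F A x y • (1 : A)

/-- The properties shared by `(ℝ, ℍ)`, `(ℝ, 𝕆)` and `(ℂ, 𝕆)` on which the geometry rests: the form
is Hermitian and positive definite, the norm is multiplicative, and the vector product of pure
elements is conjugate linear in both variables. -/
class HermitianComposition (F A : Type) [RCLike F] [NonAssocRing A] [Star A] [Norm A] [Module F A]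
    [HasFPart F A] : Prop where
  conj_form : ∀ x y : A, conj (form F A x y) = form F A y x
  form_smul_right : ∀ (t : F) (x y : A), form F A x (t • y) = t * form F A x y
  form_self : ∀ x : A, form F A x x = ((‖x‖ ^ 2 : ℝ) : F)
  norm_nonneg' : ∀ x : A, 0 ≤ ‖x‖
  eq_zero_of_norm_eq_zero : ∀ x : A, ‖x‖ = 0 → x = 0
  norm_one' : ‖(1 : A)‖ = 1
  norm_mul' : ∀ x y : A, ‖x * y‖ = ‖x‖ * ‖y‖
  star_one' : star (1 : A) = 1
  star_of_mem_Pu : ∀ x ∈ Pu F A, star x = -x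
  mul_smul_one : ∀ (x : A) (t : F), x * t • (1 : A) = t • x
  cross_smul_left : ∀ (t : F) (x : A), ∀ y ∈ Pu F A,
    cross F (t • x) y = conj t • cross F x y
  cross_smul_right : ∀ (t : F), ∀ x ∈ Pu F A, ∀ y ∈ Pu F A,
    cross F x (t • y) = conj t • cross F x y
  mul_mul_self : ∀ x ∈ Pu F A, ∀ y : A, x * (x * y) = -((‖x‖ ^ 2 : ℝ) : F) • y

theorem norm_sq_quaternion (x : ℍ[ℝ]) :
    ‖x‖ ^ 2 = x.re ^ 2 + x.imI ^ 2 + x.imJ ^ 2 + x.imK ^ 2 := by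
  rw [pow_two, ← Quaternion.normSq_eq_norm_mul_self, Quaternion.normSq_def']

instance : HermitianComposition ℝ ℍ[ℝ] where
  conj_form x y := by simp [form_real_quaternion]; ring
  form_smul_right t x y := by simp [form_real_quaternion]
  form_self x := by rw [norm_sq_quaternion]; simp [form_real_quaternion]; ring
  norm_nonneg' := norm_nonneg
  eq_zero_of_norm_eq_zero _ := norm_eq_zero.1
  norm_one' := norm_one
  norm_mul' := norm_mul
  star_one' := star_one _
  star_of_mem_Pu x hx := by
    rw [mem_Pu_real_quaternion] at hx
    ext <;> simp [hx]
  mul_smul_one x t := by simp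
  cross_smul_left t x y _ := by
    ext <;> simp [cross, form_real_quaternion, mul_add]
  cross_smul_right t x _ y _ := by
    ext <;> simp [cross, form_real_quaternion, mul_add]
  mul_mul_self x hx y := by
    rw [mem_Pu_real_quaternion] at hx
    rw [norm_sq_quaternion]
    ext <;> simp [hx] <;> ring

namespace Octonion

theorem norm_sq_eq (x : Octonion) : ‖x‖ ^ 2 =
    x.fst.re ^ 2 + x.fst.imI ^ 2 + x.fst.imJ ^ 2 + x.fst.imK ^ 2 +
      (x.snd.re ^ 2 + x.snd.imI ^ 2 + x.snd.imJ ^ 2 + x.snd.imK ^ 2) := by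
  rw [norm_sq, norm_sq_quaternion, norm_sq_quaternion]

protected theorem norm_nonneg (x : Octonion) : 0 ≤ ‖x‖ := Real.sqrt_nonneg _

theorem eq_zero_of_norm_eq_zero (x : Octonion) (h : ‖x‖ = 0) : x = 0 := by
  have hx : ‖x.fst‖ ^ 2 + ‖x.snd‖ ^ 2 = 0 := by rw [← norm_sq, h, zero_pow two_ne_zero]
  rw [add_eq_zero_iff_of_nonneg (sq_nonneg _) (sq_nonneg _)] at hx
  ext1
  · exact norm_eq_zero.1 (sq_eq_zero_iff.1 hx.1)
  · exact norm_eq_zero.1 (sq_eq_zero_iff.1 hx.2)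

protected theorem norm_one : ‖(1 : Octonion)‖ = 1 := by simp [norm_def]

/-- Degen's eight-square identity. -/
protected theorem norm_mul (x y : Octonion) : ‖x * y‖ = ‖x‖ * ‖y‖ := by
  rw [← sq_eq_sq₀ (Octonion.norm_nonneg _)
    (mul_nonneg (Octonion.norm_nonneg _) (Octonion.norm_nonneg _)), mul_pow]
  simp only [norm_sq_eq, mul_fst, mul_snd, Quaternion.re_sub, Quaternion.imI_sub,
    Quaternion.imJ_sub, Quaternion.imK_sub, Quaternion.re_add, Quaternion.imI_add,
    Quaternion.imJ_add, Quaternion.imK_add, Quaternion.re_mul, Quaternion.imI_mul,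
    Quaternion.imJ_mul, Quaternion.imK_mul, Quaternion.re_star, Quaternion.imI_star,
    Quaternion.imJ_star, Quaternion.imK_star]
  ring

theorem star_one : star (1 : Octonion) = 1 := by ext <;> simp

theorem star_of_re_eq_zero {x : Octonion} (hx : x.fst.re = 0) : star x = -x := by
  ext <;> simp [hx]

theorem mul_mul_self_of_re_eq_zero {x : Octonion} (hx : x.fst.re = 0) (y : Octonion) :
    x * (x * y) = -(‖x‖ ^ 2) • y := by
  rw [norm_sq_eq]
  ext <;> simp [hx] <;> ring

/-- The octonions as `ℂ⁴`. The sign in the second coordinate comes from `j * i = -k`, the complex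
scalars acting on the right of `fst`. -/
noncomputable def complexEquiv : Octonion ≃ₗ[ℂ] (Fin 4 → ℂ) where
  toFun x := ![⟨x.fst.re, x.fst.imI⟩, ⟨x.fst.imJ, -x.fst.imK⟩, ⟨x.snd.re, x.snd.imI⟩,
    ⟨x.snd.imJ, x.snd.imK⟩]
  invFun z :=
    ⟨⟨(z 0).re, (z 0).im, (z 1).re, -(z 1).im⟩, ⟨(z 2).re, (z 2).im, (z 3).re, (z 3).im⟩⟩
  map_add' x y := by
    funext i
    fin_cases i <;> apply Complex.ext <;> simp [add_comm]
  map_smul' c x := by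
    funext i
    fin_cases i <;> apply Complex.ext <;> simp <;> ring
  left_inv x := by ext <;> simp
  right_inv z := by
    funext i
    fin_cases i <;> apply Complex.ext <;> simp

theorem cross_complex_smul_left (t : ℂ) (x : Octonion) {y : Octonion}
    (hy : y ∈ Pu ℂ Octonion) : cross ℂ (t • x) y = conj t • cross ℂ x y := by
  rw [mem_Pu_complex_octonion] at hy
  ext <;> simp [cross, form_complex_octonion, hy.1, hy.2] <;> ring

theorem cross_complex_smul_right (t : ℂ) {x y : Octonion} (hx : x ∈ Pu ℂ Octonion)
    (hy : y ∈ Pu ℂ Octonion) : cross ℂ x (t • y) = conj t • cross ℂ x y := by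
  rw [mem_Pu_complex_octonion] at hx hy
  ext <;> simp [cross, form_complex_octonion, hx.1, hx.2, hy.1, hy.2] <;> ring

theorem finrank_complex : Module.finrank ℂ Octonion = 4 := by
  rw [complexEquiv.finrank_eq, Module.finrank_fin_fun]

theorem finrank_real : Module.finrank ℝ Octonion = 8 := by
  rw [finrank_real_of_complex, finrank_complex]

end Octonion

instance : HermitianComposition ℝ Octonion where
  conj_form x y := by simp [form_real_octonion]; ring
  form_smul_right t x y := by simp [form_real_octonion]; ring
  form_self x := by rw [Octonion.norm_sq_eq]; simp [form_real_octonion]; ring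
  norm_nonneg' := Octonion.norm_nonneg
  eq_zero_of_norm_eq_zero := Octonion.eq_zero_of_norm_eq_zero
  norm_one' := Octonion.norm_one
  norm_mul' := Octonion.norm_mul
  star_one' := Octonion.star_one
  star_of_mem_Pu _ hx := Octonion.star_of_re_eq_zero hx
  mul_smul_one x t := by ext <;> simp
  cross_smul_left t x y _ := by ext <;> simp [cross, form_real_octonion] <;> ring
  cross_smul_right t x _ y _ := by ext <;> simp [cross, form_real_octonion] <;> ring
  mul_mul_self _ hx y := Octonion.mul_mul_self_of_re_eq_zero hx y

instance : HermitianComposition ℂ Octonion where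
  conj_form x y := by apply Complex.ext <;> simp [form_complex_octonion] <;> ring
  form_smul_right t x y := by apply Complex.ext <;> simp [form_complex_octonion] <;> ring
  form_self x := by
    rw [Octonion.norm_sq_eq]
    apply Complex.ext <;> simp [form_complex_octonion, pow_two]; ring
  norm_nonneg' := Octonion.norm_nonneg
  eq_zero_of_norm_eq_zero := Octonion.eq_zero_of_norm_eq_zero
  norm_one' := Octonion.norm_one
  norm_mul' := Octonion.norm_mul
  star_one' := Octonion.star_one
  star_of_mem_Pu _ hx := Octonion.star_of_re_eq_zero ((mem_Pu_complex_octonion _).1 hx).1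
  mul_smul_one x t := by ext <;> simp
  cross_smul_left t x _ hy := Octonion.cross_complex_smul_left t x hy
  cross_smul_right t _ hx _ hy := Octonion.cross_complex_smul_right t hx hy
  mul_mul_self x hx y := by
    rw [Octonion.mul_mul_self_of_re_eq_zero ((mem_Pu_complex_octonion _).1 hx).1]
    ext <;> simp [pow_two] <;> ring

section InnerProductSpace

variable {𝕜 E : Type*} [RCLike 𝕜] [NormedAddCommGroup E] [InnerProductSpace 𝕜 E]

open Module

theorem exists_ne_zero_inner_eq_zero (h : 2 < finrank 𝕜 E) (x y : E) :
    ∃ z : E, z ≠ 0 ∧ inner 𝕜 x z = 0 ∧ inner 𝕜 y z = 0 := by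
  have : FiniteDimensional 𝕜 E := Module.finite_of_finrank_pos (Nat.zero_lt_of_lt h)
  have hker : LinearMap.ker ((innerₛₗ 𝕜 x).prod (innerₛₗ 𝕜 y)) ≠ ⊥ :=
    LinearMap.ker_ne_bot_of_finrank_lt (by simpa using h)
  obtain ⟨z, hz, hz0⟩ := (Submodule.ne_bot_iff _).1 hker
  exact ⟨z, hz0, Prod.mk_eq_zero.1 hz⟩

theorem exists_smul_eq_of_inner_eq_zero (h : finrank 𝕜 E = 3) {x y z w : E}
    (hxy : LinearIndependent 𝕜 ![x, y]) (hz : z ≠ 0)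
    (hxz : inner 𝕜 x z = 0) (hyz : inner 𝕜 y z = 0)
    (hxw : inner 𝕜 x w = 0) (hyw : inner 𝕜 y w = 0) : ∃ t : 𝕜, t • z = w := by
  have : FiniteDimensional 𝕜 E := Module.finite_of_finrank_pos (by rw [h]; norm_num)
  have mem_orthogonal {v : E} (hx : inner 𝕜 x v = 0) (hy : inner 𝕜 y v = 0) :
      v ∈ (Submodule.span 𝕜 (Set.range ![x, y]))ᗮ := by
    have hle : Submodule.span 𝕜 (Set.range ![x, y]) ≤ (𝕜 ∙ v)ᗮ := by
      rw [Submodule.span_le, Matrix.range_cons_cons_empty, Set.pair_subset_iff]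
      exact ⟨Submodule.mem_orthogonal_singleton_iff_inner_left.2 hx,
        Submodule.mem_orthogonal_singleton_iff_inner_left.2 hy⟩
    exact Submodule.le_orthogonal_iff_le_orthogonal.1 hle (Submodule.mem_span_singleton_self v)
  have hline : finrank 𝕜 (Submodule.span 𝕜 (Set.range ![x, y]))ᗮ = 1 := by
    have hsum := (Submodule.span 𝕜 (Set.range ![x, y])).finrank_add_finrank_orthogonal
    rw [finrank_span_eq_card hxy, Fintype.card_fin, h] at hsum
    omega
  obtain ⟨t, ht⟩ := (finrank_eq_one_iff_of_nonzero' ⟨z, mem_orthogonal hxz hyz⟩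
    (by simpa using hz)).1 hline ⟨w, mem_orthogonal hxw hyw⟩
  exact ⟨t, congrArg Subtype.val ht⟩

end InnerProductSpace

namespace HermitianComposition

variable {F A : Type} [RCLike F] [NonAssocRing A] [Star A] [Norm A] [Module F A] [HasFPart F A]

theorem form_add_right (x y z : A) : form F A x (y + z) = form F A x y + form F A x z := by
  simp only [form, mul_add, map_add]

theorem form_zero_right (x : A) : form F A x 0 = 0 := by simp only [form, mul_zero, map_zero]

variable [HermitianComposition F A]

theorem form_add_left (x y z : A) : form F A (x + y) z = form F A x z + form F A y z := by
  simp only [← conj_form (F := F) z, form_add_right, map_add]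

theorem form_smul_left (t : F) (x y : A) : form F A (t • x) y = conj t * form F A x y := by
  rw [← conj_form y, form_smul_right, map_mul, conj_form]

theorem form_eq_zero_symm {x y : A} (h : form F A x y = 0) : form F A y x = 0 := by
  rw [← conj_form, h, map_zero]

theorem form_self_eq_zero {x : A} : form F A x x = 0 ↔ x = 0 := by
  refine ⟨fun h => ?_, fun h => by rw [h, form_zero_right]⟩
  rw [form_self, RCLike.ofReal_eq_zero] at h
  exact eq_zero_of_norm_eq_zero F x (sq_eq_zero_iff.1 h)

theorem form_mul_mul (x y : A) : form F A (x * y) (x * y) = form F A x x * form F A y y := by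
  rw [form_self, form_self, form_self, norm_mul' F, mul_pow, RCLike.ofReal_mul]

theorem norm_eq_norm_of_form_self {B : Type} [NonAssocRing B] [Star B] [Norm B] [Module F B]
    [HasFPart F B] [HermitianComposition F B] {x : A} {y : B}
    (h : form F A x x = form F B y y) : ‖x‖ = ‖y‖ := by
  rw [form_self, form_self, RCLike.ofReal_inj] at h
  exact (sq_eq_sq₀ (norm_nonneg' F x) (norm_nonneg' F y)).1 h

variable (F) in
include F in
theorem eq_zero_or_eq_zero_of_mul_eq_zero {x y : A} (h : x * y = 0) : x = 0 ∨ y = 0 := by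
  have hmul : form F A x x * form F A y y = 0 := by rw [← form_mul_mul, h, form_zero_right]
  simpa only [mul_eq_zero, form_self_eq_zero] using hmul

theorem exists_form_smul_self_eq_one {x : A} (hx : x ≠ 0) :
    ∃ t : F, t ≠ 0 ∧ form F A (t • x) (t • x) = 1 := by
  have hn : ‖x‖ ≠ 0 := fun h => hx (eq_zero_of_norm_eq_zero F x h)
  refine ⟨(‖x‖⁻¹ : ℝ), RCLike.ofReal_ne_zero.2 (inv_ne_zero hn), ?_⟩
  rw [form_smul_left, form_smul_right, form_self, RCLike.conj_ofReal, ← RCLike.ofReal_mul,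
    ← RCLike.ofReal_mul, show ‖x‖⁻¹ * (‖x‖⁻¹ * ‖x‖ ^ 2) = 1 by field_simp, RCLike.ofReal_one]

theorem form_one_one : form F A 1 1 = 1 := by
  rw [form_self, norm_one' F, one_pow, RCLike.ofReal_one]

theorem form_one_left (x : A) : form F A 1 x = HasFPart.fPart (F := F) x := by
  rw [form, star_one' F, one_mul]

theorem mem_Pu_iff {x : A} : x ∈ Pu F A ↔ form F A 1 x = 0 := by
  rw [form_one_left]
  exact Iff.rfl

theorem form_of_mem_Pu {x : A} (hx : x ∈ Pu F A) (y : A) :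
    form F A x y = -form F A 1 (x * y) := by
  rw [form_one_left, form, star_of_mem_Pu x hx, neg_mul, map_neg]

theorem finrank_Pu_add_one [FiniteDimensional F A] :
    Module.finrank F (Pu F A) + 1 = Module.finrank F A := by
  refine Module.Dual.finrank_ker_add_one_of_ne_zero fun h => one_ne_zero (α := F) ?_
  rw [← form_one_one (A := A), form_one_left, h, LinearMap.zero_apply]

variable (F A) in
/-- The form as an inner product on `Pu_𝔽(𝔸)`, which gives access to orthogonal complements. -/
@[reducible] noncomputable def puCore : InnerProductSpace.Core F (Pu F A) where
  inner x y := form F A x y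
  conj_inner_symm x y := conj_form (y : A) x
  re_inner_nonneg x := by
    rw [form_self, RCLike.ofReal_re]
    positivity
  add_left x y z := form_add_left (x : A) y z
  smul_left x y t := form_smul_left t (x : A) y
  definite x h := Subtype.ext (form_self_eq_zero.1 h)

variable (F) in
/-- An orthonormal pair of pure elements. Such pairs serve as frames: a plane is determined by the
images of one, and these may be any orthonormal pair of `𝕆`. -/
structure OrthonormalPair (a b : A) : Prop where
  left_mem : a ∈ Pu F A
  right_mem : b ∈ Pu F A
  left_self : form F A a a = 1
  right_self : form F A b b = 1
  left_right : form F A a b = 0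

variable (F) in
/-- The element with coordinates `z`, `α`, `β`, `γ` in the basis `1`, `a`, `b`, `a * b` that an
orthonormal pair `a`, `b` generates. -/
def quad (a b : A) (z α β γ : F) : A := z • (1 : A) + α • a + β • b + γ • (a * b)

theorem form_quad_left (a b : A) (z α β γ : F) (x : A) : form F A (quad F a b z α β γ) x =
    conj z * form F A 1 x + conj α * form F A a x + conj β * form F A b x +
      conj γ * form F A (a * b) x := by
  simp only [quad, form_add_left, form_smul_left]

theorem smul_one_mul (t : F) {x : A} (hx : x ∈ Pu F A) : t • (1 : A) * x = conj t • x := by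
  have h := cross_smul_left t 1 x hx
  rwa [cross, cross, form_smul_left, mem_Pu_iff.1 hx, mul_zero, zero_smul, add_zero, add_zero,
    one_mul] at h

theorem smul_one_mul_smul {x : A} (hx : x ∈ Pu F A) (s t : F) :
    (s • (1 : A)) * (t • x) = (conj s * t) • x := by
  rw [smul_one_mul s ((Pu F A).smul_mem t hx), smul_smul]

theorem smul_mul_smul_one (x : A) (s t : F) : (s • x) * (t • (1 : A)) = (t * s) • x := by
  rw [mul_smul_one, smul_smul]

theorem mul_self_of_mem_Pu {x : A} (hx : x ∈ Pu F A) : x * x = -form F A x x • (1 : A) := by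
  simpa only [mul_one, ← form_self] using mul_mul_self (F := F) x hx 1

theorem mul_comm_neg_of_orthogonal {x y : A} (hx : x ∈ Pu F A) (hy : y ∈ Pu F A)
    (h : form F A x y = 0) : y * x = -(x * y) := by
  have hxy := mul_self_of_mem_Pu ((Pu F A).add_mem hx hy)
  rw [add_mul, mul_add, mul_add, mul_self_of_mem_Pu hx, mul_self_of_mem_Pu hy, form_add_left,
    form_add_right, form_add_right, h, form_eq_zero_symm h] at hxy
  linear_combination (norm := module) hxy

namespace OrthonormalPair

variable {a b : A} (h : OrthonormalPair F a b)
include h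

theorem symm : OrthonormalPair F b a where
  left_mem := h.right_mem
  right_mem := h.left_mem
  left_self := h.right_self
  right_self := h.left_self
  left_right := form_eq_zero_symm h.left_right

theorem mul_mem : a * b ∈ Pu F A := by
  rw [mem_Pu_iff, ← neg_eq_zero, ← form_of_mem_Pu h.left_mem, h.left_right]

theorem mul_comm_neg : b * a = -(a * b) :=
  mul_comm_neg_of_orthogonal h.left_mem h.right_mem h.left_right

theorem left_mul_mul : a * (a * b) = -b := by
  rw [mul_mul_self (F := F) a h.left_mem, ← form_self, h.left_self, neg_one_smul]

theorem right_mul_mul : b * (a * b) = a := by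
  rw [← neg_inj, ← mul_neg, ← h.mul_comm_neg, h.symm.left_mul_mul]

theorem right_mul : form F A b (a * b) = 0 := by
  rw [form_of_mem_Pu h.right_mem, h.right_mul_mul, mem_Pu_iff.1 h.left_mem, neg_zero]

/-- The triple `a`, `b`, `a * b` has a cyclic symmetry, since `b * (a * b) = a`. -/
theorem rotate : OrthonormalPair F b (a * b) where
  left_mem := h.right_mem
  right_mem := h.mul_mem
  left_self := h.right_self
  right_self := by rw [form_mul_mul, h.left_self, h.right_self, one_mul]
  left_right := h.right_mul

theorem rotate_rotate : OrthonormalPair F (a * b) a := by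
  simpa only [h.right_mul_mul] using h.rotate.rotate

theorem mul_mul_left : a * b * a = b := by
  simpa only [h.right_mul_mul] using h.rotate.right_mul_mul

theorem smul_mul_smul (s t : F) : (s • a) * (t • b) = conj (s * t) • (a * b) := by
  have hcross := cross_smul_left s a (t • b) ((Pu F A).smul_mem t h.right_mem)
  rw [cross_smul_right t a h.left_mem b h.right_mem] at hcross
  simpa only [cross, form_smul_left, form_smul_right, h.left_right, mul_zero, zero_smul, add_zero,
    smul_smul, map_mul] using hcross

theorem smul_mul_smul_self (s t : F) : (s • a) * (t • a) = -(conj s * t) • (1 : A) := by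
  have hcross := cross_smul_left s a (t • a) ((Pu F A).smul_mem t h.left_mem)
  rw [cross_smul_right t a h.left_mem a h.left_mem] at hcross
  have ha : a * a = -1 := by rw [mul_self_of_mem_Pu h.left_mem, h.left_self, neg_one_smul]
  simp only [cross, form_smul_left, form_smul_right, h.left_self, ha, one_smul, mul_one,
    neg_add_cancel, smul_zero] at hcross
  rw [eq_neg_of_add_eq_zero_left hcross, neg_smul, mul_comm]

theorem quad_mul (z α β γ z' α' β' γ' : F) : quad F a b z α β γ * quad F a b z' α' β' γ' =
    quad F a b (z * z' - conj α * α' - conj β * β' - conj γ * γ')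
      (conj z * α' + z' * α + conj (β * γ') - conj (γ * β'))
      (conj z * β' + z' * β + conj (γ * α') - conj (α * γ'))
      (conj z * γ' + z' * γ + conj (α * β') - conj (β * α')) := by
  have hb := h.rotate
  have hab := h.rotate_rotate
  simp only [quad, add_mul, mul_add, smul_mul_smul_one, smul_one_mul_smul h.left_mem,
    smul_one_mul_smul hb.left_mem, smul_one_mul_smul hab.left_mem,
    h.smul_mul_smul_self, hb.smul_mul_smul_self, hab.smul_mul_smul_self,
    h.smul_mul_smul, hb.smul_mul_smul, hab.smul_mul_smul,
    h.symm.smul_mul_smul, hb.symm.smul_mul_smul, hab.symm.smul_mul_smul,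
    h.mul_comm_neg, hb.mul_comm_neg, h.left_mul_mul, h.right_mul_mul, h.mul_mul_left]
  module

theorem form_one_quad (z α β γ : F) : form F A 1 (quad F a b z α β γ) = z := by
  simp only [quad, form_add_right, form_smul_right, form_one_one, mem_Pu_iff.1 h.left_mem,
    mem_Pu_iff.1 h.right_mem, mem_Pu_iff.1 h.mul_mem, mul_one, mul_zero, add_zero]

theorem form_left_quad (z α β γ : F) : form F A a (quad F a b z α β γ) = α := by
  simp only [quad, form_add_right, form_smul_right, form_eq_zero_symm (mem_Pu_iff.1 h.left_mem),
    h.left_self, h.left_right, h.rotate_rotate.symm.left_right, mul_one, mul_zero, add_zero,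
    zero_add]

theorem form_right_quad (z α β γ : F) : form F A b (quad F a b z α β γ) = β := by
  simp only [quad, form_add_right, form_smul_right, form_eq_zero_symm (mem_Pu_iff.1 h.right_mem),
    h.right_self, h.symm.left_right, h.right_mul, mul_one, mul_zero, add_zero, zero_add]

theorem form_mul_quad (z α β γ : F) : form F A (a * b) (quad F a b z α β γ) = γ := by
  simp only [quad, form_add_right, form_smul_right, form_eq_zero_symm (mem_Pu_iff.1 h.mul_mem),
    h.rotate.right_self, h.rotate_rotate.left_right, h.rotate.symm.left_right, mul_one, mul_zero,
    zero_add]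

theorem eq_quad (hA : Module.finrank F A = 4) (x : A) :
    x = quad F a b (form F A 1 x) (form F A a x) (form F A b x) (form F A (a * b) x) := by
  let f : (Fin 4 → F) →ₗ[F] A :=
    { toFun v := quad F a b (v 0) (v 1) (v 2) (v 3)
      map_add' v w := by simp only [quad, Pi.add_apply]; module
      map_smul' t v := by simp only [quad, Pi.smul_apply, smul_eq_mul, RingHom.id_apply]; module }
  have hf : Function.Injective f := by
    intro v w hvw
    change quad F a b (v 0) (v 1) (v 2) (v 3) = quad F a b (w 0) (w 1) (w 2) (w 3) at hvw
    funext i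
    fin_cases i
    · simpa only [h.form_one_quad] using! congrArg (form F A 1) hvw
    · simpa only [h.form_left_quad] using! congrArg (form F A a) hvw
    · simpa only [h.form_right_quad] using! congrArg (form F A b) hvw
    · simpa only [h.form_mul_quad] using! congrArg (form F A (a * b)) hvw
  have : FiniteDimensional F A := Module.finite_of_finrank_pos (by rw [hA]; norm_num)
  obtain ⟨v, hv⟩ := (LinearMap.injective_iff_surjective_of_finrank_eq_finrank
    (by rw [hA, Module.finrank_fin_fun])).1 hf x
  replace hv : x = quad F a b (v 0) (v 1) (v 2) (v 3) := hv.symm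
  rw [hv, h.form_one_quad, h.form_left_quad, h.form_right_quad, h.form_mul_quad]

end OrthonormalPair

end HermitianComposition

open HermitianComposition Module

section Incidence

variable {F A : Type} [RCLike F] [NonAssocRing A] [Module F A] [Module F Octonion]

theorem pairClass_smul {t : F} (ht : t ≠ 0) (x : A) (u : Octonion) :
    pairClass (F := F) (t • x) (t • u) = pairClass (F := F) x u := by
  ext w
  constructor
  · rintro ⟨s, hs, rfl⟩
    exact ⟨s * t, mul_ne_zero hs ht, by rw [mul_smul, mul_smul]⟩
  · rintro ⟨s, hs, rfl⟩
    refine ⟨s * t⁻¹, mul_ne_zero hs (inv_ne_zero ht), ?_⟩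
    rw [smul_smul, smul_smul, inv_mul_cancel_right₀ ht]

theorem mem_pairClass_self (x : A) (u : Octonion) : (x, u) ∈ pairClass (F := F) x u :=
  ⟨1, one_ne_zero, by rw [one_smul, one_smul]⟩

variable [Star A] [Norm A] [HasFPart F A] [HasFPart F Octonion]

theorem Line.on_iff_map_eq {L : Line F A} {x : A} {u : Octonion}
    (hL : L.carrier = pairClass (F := F) x u) {φ : Plane F A} :
    L.On φ ↔ φ.toLinearMap x = u := by
  constructor
  · intro h
    exact h (x, u) (hL ▸ mem_pairClass_self x u)
  · intro h w hw
    rw [hL] at hw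
    obtain ⟨t, -, rfl⟩ := hw
    rw [map_smul, h]

namespace Plane

theorem map_form (φ : Plane F A) (x y : A) :
    form F Octonion (φ.toLinearMap x) (φ.toLinearMap y) = form F A x y := φ.map_form' x y

protected theorem map_mul (φ : Plane F A) (x y : A) :
    φ.toLinearMap (x * y) = φ.toLinearMap x * φ.toLinearMap y := φ.map_mul' x y

theorem map_add_map_ne_zero {φ ψ : Plane F A} {y x : A}
    (hy : φ.toLinearMap y = ψ.toLinearMap y) (hyx : form F A y x ≠ 0) :
    φ.toLinearMap x + ψ.toLinearMap x ≠ 0 := by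
  intro h
  have htwo : form F Octonion (φ.toLinearMap y) (φ.toLinearMap x + ψ.toLinearMap x) =
      2 * form F A y x := by
    rw [form_add_right, φ.map_form, hy, ψ.map_form, two_mul]
  rw [h, form_zero_right] at htwo
  exact mul_ne_zero two_ne_zero hyx htwo.symm

end Plane

end Incidence

section Geometry

variable {F A : Type} [RCLike F] [NonAssocRing A] [Star A] [Norm A] [Module F A] [HasFPart F A]
  [HermitianComposition F A]

theorem exists_Pu_form_eq_zero (hA : 3 < finrank F A) (x y : Pu F A) :
    ∃ z : Pu F A, z ≠ 0 ∧ form F A x z = 0 ∧ form F A y z = 0 := by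
  let := (puCore F A).toNormedAddCommGroup
  let := InnerProductSpace.ofCore (puCore F A).toCore
  have : FiniteDimensional F A := Module.finite_of_finrank_pos (Nat.zero_lt_of_lt hA)
  have hPu := finrank_Pu_add_one (F := F) (A := A)
  exact exists_ne_zero_inner_eq_zero (by omega) x y

theorem exists_smul_eq_of_form_eq_zero (hA : finrank F A = 4) {x y z w : Pu F A}
    (hxy : LinearIndependent F ![x, y]) (hz : z ≠ 0)
    (hxz : form F A x z = 0) (hyz : form F A y z = 0)
    (hxw : form F A x w = 0) (hyw : form F A y w = 0) : ∃ t : F, t • z = w := by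
  let := (puCore F A).toNormedAddCommGroup
  let := InnerProductSpace.ofCore (puCore F A).toCore
  have : FiniteDimensional F A := Module.finite_of_finrank_pos (by rw [hA]; norm_num)
  have hPu := finrank_Pu_add_one (F := F) (A := A)
  exact exists_smul_eq_of_inner_eq_zero (by omega) hxy hz hxz hyz hxw hyw

theorem exists_orthonormalPair (hA : 3 < finrank F A) {u v : A} (hu : u ∈ Pu F A)
    (hv : v ∈ Pu F A) (hu1 : form F A u u = 1) (hv1 : form F A v v = 1) :
    ∃ w, OrthonormalPair F u w ∧ OrthonormalPair F v w := by
  obtain ⟨z, hz, huz, hvz⟩ := exists_Pu_form_eq_zero hA ⟨u, hu⟩ ⟨v, hv⟩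
  obtain ⟨t, -, ht⟩ := exists_form_smul_self_eq_one (F := F) (fun h => hz (Subtype.ext h))
  have hw := (Pu F A).smul_mem t z.2
  exact ⟨t • z, ⟨hu, hw, hu1, ht, by rw [form_smul_right, huz, mul_zero]⟩,
    ⟨hv, hw, hv1, ht, by rw [form_smul_right, hvz, mul_zero]⟩⟩

namespace Point

open Projectivization

theorem exists_unit_rep (p : Point F A) :
    ∃ (x : Pu F A) (hx : x ≠ 0), form F A x x = 1 ∧ p = mk F x hx := by
  obtain ⟨t, ht, h1⟩ := exists_form_smul_self_eq_one (F := F) (x := (p.rep : A))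
    (fun h => p.rep_nonzero (Subtype.ext h))
  refine ⟨t • p.rep, smul_ne_zero ht p.rep_nonzero, h1, ?_⟩
  rw [← p.mk_rep, mk_eq_mk_iff']
  exact ⟨t⁻¹, by rw [mk_rep, inv_smul_smul₀ ht]⟩

theorem mk_perp_mk {x y : Pu F A} (hx : x ≠ 0) (hy : y ≠ 0) :
    Perp (mk F x hx) (mk F y hy) ↔ form F A x y = 0 := by
  simp only [Perp, submodule_mk, Submodule.mem_span_singleton]
  constructor
  · exact fun h => h x ⟨1, one_smul F x⟩ y ⟨1, one_smul F y⟩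
  · rintro h _ ⟨s, rfl⟩ _ ⟨t, rfl⟩
    simp only [Submodule.coe_smul, form_smul_left, form_smul_right, h, mul_zero]

theorem Perp.symm {p q : Point F A} (h : p.Perp q) : q.Perp p :=
  fun y hy x hx => form_eq_zero_symm (h x hx y hy)

theorem Perp.ne {p q : Point F A} (h : p.Perp q) : p ≠ q := by
  obtain ⟨x, hx, hx1, rfl⟩ := p.exists_unit_rep
  rintro rfl
  rw [mk_perp_mk, hx1] at h
  exact one_ne_zero h

theorem exists_perp (hA : 3 < finrank F A) (p q : Point F A) : ∃ r, p.Perp r ∧ q.Perp r := by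
  induction p using ind with | h x hx =>
  induction q using ind with | h y hy =>
  obtain ⟨z, hz, hxz, hyz⟩ := exists_Pu_form_eq_zero hA x y
  exact ⟨mk F z hz, (mk_perp_mk hx hz).2 hxz, (mk_perp_mk hy hz).2 hyz⟩

theorem eq_of_perp (hA : finrank F A = 4) {p q r s : Point F A} (hpq : p ≠ q)
    (hpr : p.Perp r) (hqr : q.Perp r) (hps : p.Perp s) (hqs : q.Perp s) : r = s := by
  induction p using ind with | h x hx =>
  induction q using ind with | h y hy =>
  induction r using ind with | h z hz =>
  induction s using ind with | h w hw =>
  rw [mk_perp_mk] at hpr hqr hps hqs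
  have hxy : LinearIndependent F ![x, y] := (LinearIndependent.pair_iff' hx).2 fun t ht =>
    hpq ((mk_eq_mk_iff' F _ _ hx hy).2 ⟨t⁻¹, by
      rw [← ht, inv_smul_smul₀]
      rintro rfl
      exact hy (by rw [← ht, zero_smul])⟩)
  obtain ⟨t, ht⟩ := exists_smul_eq_of_form_eq_zero hA hxy hz hpr hqr hps hqs
  exact ((mk_eq_mk_iff' F _ _ hw hz).2 ⟨t, ht⟩).symm

end Point

variable [Module F Octonion] [HasFPart F Octonion] [HermitianComposition F Octonion]

namespace Line

theorem exists_nonzero_rep (L : Line F A) : ∃ x : Pu F A, x ≠ 0 ∧ ∃ u ∈ Pu F Octonion,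
    form F Octonion u u = form F A x x ∧ L.carrier = pairClass (F := F) (x : A) u := by
  obtain ⟨x, hx, u, hu, hn, hu0, hL⟩ := L.exists_rep
  have hx0 : x ≠ 0 := by
    rintro rfl
    rw [← hn] at hu0
    have hzero := HasFPart.norm_smul' (0 : F) (0 : A)
    rw [smul_zero, norm_zero, zero_mul] at hzero
    exact hu0 hzero
  exact ⟨⟨x, hx⟩, fun h => hx0 (congrArg Subtype.val h), u, hu,
    by rw [form_self, form_self, hn], hL⟩

/-- The point `[x]` of the line `[x, u]`; a point is on the line when it is orthogonal to `[x]`. -/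
noncomputable def pole (L : Line F A) : Point F A :=
  Projectivization.mk F L.exists_nonzero_rep.choose L.exists_nonzero_rep.choose_spec.1

theorem exists_carrier_eq {L : Line F A} {x : Pu F A} {hx : x ≠ 0}
    (h : L.pole = Projectivization.mk F x hx) : ∃ u ∈ Pu F Octonion,
      form F Octonion u u = form F A x x ∧ L.carrier = pairClass (F := F) (x : A) u := by
  obtain ⟨hy, u, hu, hyu, hL⟩ := L.exists_nonzero_rep.choose_spec
  obtain ⟨t, ht⟩ := (Projectivization.mk_eq_mk_iff F _ _ hx hy).1 h.symm
  have hx' : (t : F) • (L.exists_nonzero_rep.choose : A) = x := congrArg Subtype.val ht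
  refine ⟨(t : F) • u, (Pu F Octonion).smul_mem _ hu, ?_, ?_⟩
  · rw [← hx', form_smul_left, form_smul_right, form_smul_left, form_smul_right, hyu]
  · rw [hL, ← hx', pairClass_smul t.ne_zero]

theorem pole_eq_mk {L : Line F A} {x : Pu F A} (hx : x ≠ 0) {u : Octonion}
    (h : L.carrier = pairClass (F := F) (x : A) u) : L.pole = Projectivization.mk F x hx := by
  obtain ⟨y, hy, -, hLy⟩ := L.pole.exists_unit_rep
  obtain ⟨v, -, -, hL⟩ := exists_carrier_eq hLy
  have hmem : ((x : A), u) ∈ L.carrier := h ▸ mem_pairClass_self (x : A) u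
  rw [hL] at hmem
  obtain ⟨t, -, ht⟩ := hmem
  rw [hLy, eq_comm]
  exact (Projectivization.mk_eq_mk_iff' F _ _ hx hy).2
    ⟨t, Subtype.ext (Prod.mk.inj ht).1.symm⟩

end Line

theorem Point.on_iff_pole_perp {p : Point F A} {L : Line F A} : p.On L ↔ L.pole.Perp p := by
  obtain ⟨x, hx, -, hLx⟩ := L.pole.exists_unit_rep
  obtain ⟨u, -, -, hL⟩ := Line.exists_carrier_eq hLx
  rw [hLx]
  simp only [Point.On, Point.Perp, hL, Projectivization.submodule_mk,
    Submodule.mem_span_singleton]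
  constructor
  · rintro h _ ⟨t, rfl⟩ y hy
    rw [Submodule.coe_smul, form_smul_left, h _ (mem_pairClass_self (x : A) u) y hy, mul_zero]
  · rintro h _ ⟨t, -, rfl⟩ y hy
    exact h (t • x) ⟨t, rfl⟩ y hy

theorem Line.pole_eq_pole (hA : finrank F A = 4) {p q : Point F A} (hpq : p ≠ q)
    {L M : Line F A} (hpL : p.On L) (hqL : q.On L) (hpM : p.On M) (hqM : q.On M) :
    L.pole = M.pole := by
  rw [Point.on_iff_pole_perp] at hpL hqL hpM hqM
  exact Point.eq_of_perp hA hpq hpL.symm hqL.symm hpM.symm hqM.symm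

namespace Plane

protected theorem map_one (φ : Plane F A) : φ.toLinearMap 1 = 1 := by
  have hidem : φ.toLinearMap 1 * φ.toLinearMap 1 = φ.toLinearMap 1 := by
    rw [← φ.map_mul, mul_one]
  have hne : φ.toLinearMap 1 ≠ 0 := by
    rw [Ne, ← form_self_eq_zero (F := F), map_form, form_one_one]
    exact one_ne_zero
  have hmul : φ.toLinearMap 1 * (φ.toLinearMap 1 - 1) = 0 := by
    rw [mul_sub, mul_one, hidem, sub_self]
  exact sub_eq_zero.1 ((eq_zero_or_eq_zero_of_mul_eq_zero F hmul).resolve_left hne)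

theorem map_mem_Pu (φ : Plane F A) {x : A} (hx : x ∈ Pu F A) :
    φ.toLinearMap x ∈ Pu F Octonion := by
  rw [mem_Pu_iff] at hx ⊢
  rw [← φ.map_one, map_form, hx]

/-- The line `[x, φ(x)]` of the plane `φ`, where `r = [x]`. -/
noncomputable def line (φ : Plane F A) (r : Point F A) : Line F A where
  carrier := pairClass (F := F) (r.rep : A) (φ.toLinearMap r.rep)
  exists_rep := by
    refine ⟨r.rep, r.rep.2, φ.toLinearMap r.rep, φ.map_mem_Pu r.rep.2,
      norm_eq_norm_of_form_self (φ.map_form _ _).symm, fun h => ?_, rfl⟩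
    have hr := φ.map_form r.rep r.rep
    rw [eq_zero_of_norm_eq_zero F _ h, form_zero_right, eq_comm, form_self_eq_zero] at hr
    exact r.rep_nonzero (Subtype.ext hr)

theorem pole_line (φ : Plane F A) (r : Point F A) : (φ.line r).pole = r :=
  (Line.pole_eq_mk r.rep_nonzero rfl).trans r.mk_rep

theorem on_line_iff (φ : Plane F A) {p r : Point F A} : p.On (φ.line r) ↔ r.Perp p := by
  rw [Point.on_iff_pole_perp, pole_line]

theorem line_on (φ : Plane F A) (r : Point F A) : (φ.line r).On φ :=
  (Line.on_iff_map_eq rfl).2 rfl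

theorem carrier_line_mk (φ : Plane F A) {x : Pu F A} (hx : x ≠ 0) :
    (φ.line (Projectivization.mk F x hx)).carrier =
      pairClass (F := F) (x : A) (φ.toLinearMap x) := by
  obtain ⟨u, -, -, hL⟩ := Line.exists_carrier_eq (φ.pole_line (Projectivization.mk F x hx))
  rw [hL, (Line.on_iff_map_eq hL).1 (φ.line_on _)]

theorem eq_line_of_on {φ : Plane F A} {L : Line F A} (h : L.On φ) : L = φ.line L.pole := by
  obtain ⟨x, hx, -, hLx⟩ := L.pole.exists_unit_rep
  obtain ⟨u, -, -, hL⟩ := Line.exists_carrier_eq hLx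
  apply Line.ext
  rw [hLx, carrier_line_mk, (Line.on_iff_map_eq hL).1 h, hL]

theorem ext_of_orthonormalPair (hA : finrank F A = 4) {a b : A} (h : OrthonormalPair F a b)
    {φ ψ : Plane F A} (ha : φ.toLinearMap a = ψ.toLinearMap a)
    (hb : φ.toLinearMap b = ψ.toLinearMap b) : φ = ψ := by
  have hab : φ.toLinearMap (a * b) = ψ.toLinearMap (a * b) := by
    rw [φ.map_mul, ψ.map_mul, ha, hb]
  have heq : φ.toLinearMap = ψ.toLinearMap := by
    ext1 x
    rw [h.eq_quad hA x]
    simp only [quad, map_add, map_smul, φ.map_one, ψ.map_one, ha, hb, hab]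
  cases φ
  cases ψ
  congr

theorem ext_of_lines (hA : finrank F A = 4) {L N : Line F A} (hLN : N.pole.Perp L.pole)
    {φ ψ : Plane F A} (hLφ : L.On φ) (hLψ : L.On ψ) (hNφ : N.On φ) (hNψ : N.On ψ) : φ = ψ := by
  obtain ⟨a, ha, ha1, hLa⟩ := L.pole.exists_unit_rep
  obtain ⟨b, hb, hb1, hNb⟩ := N.pole.exists_unit_rep
  obtain ⟨u, -, -, hL⟩ := Line.exists_carrier_eq hLa
  obtain ⟨w, -, -, hN⟩ := Line.exists_carrier_eq hNb
  rw [Line.on_iff_map_eq hL] at hLφ hLψ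
  rw [Line.on_iff_map_eq hN] at hNφ hNψ
  rw [hLa, hNb, Point.mk_perp_mk] at hLN
  exact ext_of_orthonormalPair hA ⟨b.2, a.2, hb1, ha1, hLN⟩ (hNφ.trans hNψ.symm)
    (hLφ.trans hLψ.symm)

/-- The plane that maps one orthonormal pair to another, given by its values on the basis
`1`, `a`, `b`, `a * b`. -/
noncomputable def ofPairs (hA : finrank F A = 4) {a b : A} {u w : Octonion}
    (h : OrthonormalPair F a b) (h' : OrthonormalPair F u w) : Plane F A where
  toFun x := quad F u w (form F A 1 x) (form F A a x) (form F A b x) (form F A (a * b) x)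
  map_add' x y := by simp only [quad, form_add_right]; module
  map_smul' t x := by simp only [quad, form_smul_right, RingHom.id_apply]; module
  map_mul' x y := by
    rw [h'.quad_mul]
    conv_lhs => rw [h.eq_quad hA x, h.eq_quad hA y, h.quad_mul]
    rw [h.form_one_quad, h.form_left_quad, h.form_right_quad, h.form_mul_quad]
  map_form' x y := by
    conv_rhs => rw [h.eq_quad hA x]
    rw [form_quad_left, form_quad_left, h'.form_one_quad, h'.form_left_quad, h'.form_right_quad,
      h'.form_mul_quad]

theorem ofPairs_left (hA : finrank F A = 4) {a b : A} {u w : Octonion}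
    (h : OrthonormalPair F a b) (h' : OrthonormalPair F u w) :
    (ofPairs hA h h').toLinearMap a = u := by
  change quad F u w _ _ _ _ = u
  rw [mem_Pu_iff.1 h.left_mem, h.left_self, h.symm.left_right, h.rotate_rotate.left_right]
  simp only [quad, zero_smul, one_smul, zero_add, add_zero]

theorem ofPairs_right (hA : finrank F A = 4) {a b : A} {u w : Octonion}
    (h : OrthonormalPair F a b) (h' : OrthonormalPair F u w) :
    (ofPairs hA h h').toLinearMap b = w := by
  change quad F u w _ _ _ _ = w
  rw [mem_Pu_iff.1 h.right_mem, h.right_self, h.left_right, h.rotate.symm.left_right]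
  simp only [quad, zero_smul, one_smul, zero_add, add_zero]

theorem inner_line_ne_neg_one {φ ψ : Plane F A} {N : Line F A} (hφ : N.On φ) (hψ : N.On ψ)
    {c : Point F A} (hc : ¬N.pole.Perp c) : (φ.line c).inner (ψ.line c) ≠ -1 := by
  obtain ⟨y, hy, -, hNy⟩ := N.pole.exists_unit_rep
  obtain ⟨x, hx, hx1, rfl⟩ := c.exists_unit_rep
  obtain ⟨u, -, -, hN⟩ := Line.exists_carrier_eq hNy
  rw [hNy, Point.mk_perp_mk] at hc
  rw [Line.on_iff_map_eq hN] at hφ hψ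
  have hinner : (φ.line (Projectivization.mk F x hx)).inner (ψ.line (Projectivization.mk F x hx)) =
      form F Octonion (φ.toLinearMap x) (ψ.toLinearMap x) := by
    rw [Line.inner_eq _ _ (carrier_line_mk φ hx ▸ mem_pairClass_self (x : A) _)
      (carrier_line_mk ψ hx ▸ mem_pairClass_self (x : A) _),
      norm_eq_norm_of_form_self (φ.map_form x x), norm_eq_norm_of_form_self (ψ.map_form x x),
      ← pow_two, ← form_self, hx1, div_one]
  rw [hinner]
  intro h
  refine map_add_map_ne_zero (hφ.trans hψ.symm) hc (form_self_eq_zero (F := F).1 ?_)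
  rw [form_add_left, form_add_right, form_add_right, φ.map_form, ψ.map_form, hx1,
    ← conj_form (φ.toLinearMap (x : A)), h, map_neg, map_one]
  ring

end Plane

theorem Line.exists_coplanar (hA : finrank F A = 4) (hO : 3 < finrank F Octonion)
    {L M : Line F A} (hLM : L.pole = M.pole) {b : Point F A} (hb : L.pole.Perp b) :
    ∃ N : Line F A, N.pole = b ∧ N.Coplanar L ∧ N.Coplanar M := by
  obtain ⟨a, ha, ha1, hLa⟩ := L.pole.exists_unit_rep
  obtain ⟨b, hb0, hb1, rfl⟩ := b.exists_unit_rep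
  rw [hLa, Point.mk_perp_mk] at hb
  obtain ⟨u, hu, hu1, hL⟩ := Line.exists_carrier_eq hLa
  obtain ⟨v, hv, hv1, hM⟩ := Line.exists_carrier_eq (hLM.symm.trans hLa)
  rw [ha1] at hu1 hv1
  obtain ⟨w, huw, hvw⟩ := exists_orthonormalPair hO hu hv hu1 hv1
  have hab : OrthonormalPair F (a : A) b := ⟨a.2, b.2, ha1, hb1, hb⟩
  let ξ := Plane.ofPairs hA hab huw
  let χ := Plane.ofPairs hA hab hvw
  have hξb : ξ.toLinearMap b = w := Plane.ofPairs_right hA hab _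
  have hχb : χ.toLinearMap b = w := Plane.ofPairs_right hA hab _
  refine ⟨ξ.line (.mk F b hb0), ξ.pole_line _, ⟨ξ, ξ.line_on _, ?_⟩, ⟨χ, ?_, ?_⟩⟩
  · exact (Line.on_iff_map_eq hL).2 (Plane.ofPairs_left hA hab _)
  · exact (Line.on_iff_map_eq (ξ.carrier_line_mk hb0)).2 (hχb.trans hξb.symm)
  · exact (Line.on_iff_map_eq hM).2 (Plane.ofPairs_left hA hab _)

namespace PrimitivePath

theorem IsOrthogonalShift.q_eq_pole (hA : finrank F A = 4) {α β : PrimitivePath F A}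
    {N : Line F A} (hNL : N.pole.Perp α.L.pole) (hNp : N.pole ≠ α.p)
    (hβ : α.IsOrthogonalShift N β) : β.q = α.L.pole := by
  obtain ⟨_, ⟨-, hqN, -, rfl, -⟩, hpq⟩ := hβ
  exact Point.eq_of_perp hA hNp (Point.on_iff_pole_perp.1 hqN) hpq hNL
    (Point.on_iff_pole_perp.1 α.p_on_L).symm

theorem IsOrthogonalShift.eq (hA : finrank F A = 4) {α β γ : PrimitivePath F A} {N : Line F A}
    (hLM : α.L.pole = α.M.pole) (hNL : N.pole.Perp α.L.pole) (hNp : N.pole ≠ α.p)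
    (hβ : α.IsOrthogonalShift N β) (hγ : α.IsOrthogonalShift N γ) : β = γ := by
  have hq : β.q = γ.q := (hβ.q_eq_pole hA hNL hNp).trans (hγ.q_eq_pole hA hNL hNp).symm
  obtain ⟨_, ⟨-, -, hp, rfl, ⟨ξ, hNξ, hLξ, hβξ⟩, χ, hNχ, hMχ, hβχ⟩, hpq⟩ := hβ
  obtain ⟨_, ⟨-, -, hp', rfl, ⟨ξ', hNξ', hLξ', hγξ⟩, χ', hNχ', hMχ', hγχ⟩, -⟩ := hγ
  obtain rfl := Plane.ext_of_lines hA hNL hLξ hLξ' hNξ hNξ'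
  obtain rfl := Plane.ext_of_lines hA (hLM ▸ hNL) hMχ hMχ' hNχ hNχ'
  have hpp : β.p = γ.p := hp.trans hp'.symm
  have hne : β.p ≠ β.q := hp ▸ hpq.ne
  have hL : β.L.pole = γ.L.pole :=
    Line.pole_eq_pole hA hne β.p_on_L β.q_on_L (hpp ▸ γ.p_on_L) (hq ▸ γ.q_on_L)
  have hM : β.M.pole = γ.M.pole :=
    Line.pole_eq_pole hA hne β.p_on_M β.q_on_M (hpp ▸ γ.p_on_M) (hq ▸ γ.q_on_M)
  refine PrimitivePath.ext hpp ?_ hq ?_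
  · rw [Plane.eq_line_of_on hβξ, hL, ← Plane.eq_line_of_on hγξ]
  · rw [Plane.eq_line_of_on hβχ, hM, ← Plane.eq_line_of_on hγχ]

end PrimitivePath

end Geometry

end OP2

open OP2 Module in
theorem lemma3p13_general {F A : Type} [RCLike F] [NonAssocRing A] [Star A] [Norm A] [Module F A]
    [HasFPart F A] [HermitianComposition F A] [Module F Octonion] [HasFPart F Octonion]
    [HermitianComposition F Octonion] (hA : finrank F A = 4) (hO : 3 < finrank F Octonion)
    (α : PrimitivePath F A) (hα : ¬α.Orthogonal) (hpq : α.p ≠ α.q) :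
    ∃ N : Line F A, α.Admissible N ∧ ∃ β : PrimitivePath F A, α.IsOrthogonalShift N β ∧
      (∀ β' : PrimitivePath F A, α.IsOrthogonalShift N β' → β' = β) ∧
      β.lineInvariant ≠ -1 := by
  have hLM := Line.pole_eq_pole hA hpq α.p_on_L α.q_on_L α.p_on_M α.q_on_M
  have hLp := Point.on_iff_pole_perp.1 α.p_on_L
  have hLq := Point.on_iff_pole_perp.1 α.q_on_L
  obtain ⟨b, hLb, hqb⟩ := Point.exists_perp (by omega) α.L.pole α.q
  obtain ⟨c, hLc, hpc⟩ := Point.exists_perp (by omega) α.L.pole α.p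
  obtain ⟨N, rfl, ⟨ξ, hNξ, hLξ⟩, χ, hNχ, hMχ⟩ := Line.exists_coplanar hA hO hLM hLb
  have hNp : N.pole ≠ α.p := fun h => hα (by rw [PrimitivePath.Orthogonal, ← h]; exact hqb.symm)
  have hNc : ¬N.pole.Perp c := fun h => hα <| by
    rwa [PrimitivePath.Orthogonal, Point.eq_of_perp hA hLb.ne hLq hqb.symm hLc h]
  have hadm : α.Admissible N :=
    ⟨Point.on_iff_pole_perp.2 hqb.symm, ⟨ξ, hNξ, hLξ⟩, χ, hNχ, hMχ⟩
  let β : PrimitivePath F A := ⟨α.p, ξ.line c, α.L.pole, χ.line c, ξ.on_line_iff.2 hpc.symm,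
    ξ.on_line_iff.2 hLc.symm, χ.on_line_iff.2 hLc.symm, χ.on_line_iff.2 hpc.symm⟩
  have hβ : α.IsOrthogonalShift N β :=
    ⟨α.L.pole, ⟨hadm, Point.on_iff_pole_perp.2 hLb.symm, rfl, rfl,
      ⟨ξ, hNξ, hLξ, ξ.line_on c⟩, χ, hNχ, hMχ, χ.line_on c⟩, hLp.symm⟩
  exact ⟨N, hadm, β, hβ, fun _ hβ' => hβ'.eq hA hLM hLb.symm hNp hβ,
    Plane.inner_line_ne_neg_one hNξ hNχ hNc⟩

theorem lemma3p13 :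
    (∀ α : OP2.PrimitivePath ℝ ℍ[ℝ], ¬ α.Orthogonal → ¬ α.Degenerate →
      ∃ N : OP2.Line ℝ ℍ[ℝ], α.Admissible N ∧
        ∃ β : OP2.PrimitivePath ℝ ℍ[ℝ], α.IsOrthogonalShift N β ∧
          (∀ β' : OP2.PrimitivePath ℝ ℍ[ℝ], α.IsOrthogonalShift N β' → β' = β) ∧
          β.lineInvariant ≠ -1) ∧
    (∀ α : OP2.PrimitivePath ℂ OP2.Octonion, ¬ α.Orthogonal → ¬ α.Degenerate →
      ∃ N : OP2.Line ℂ OP2.Octonion, α.Admissible N ∧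
        ∃ β : OP2.PrimitivePath ℂ OP2.Octonion, α.IsOrthogonalShift N β ∧
          (∀ β' : OP2.PrimitivePath ℂ OP2.Octonion, α.IsOrthogonalShift N β' → β' = β) ∧
          β.lineInvariant ≠ -1) := by
  constructor
  · intro α hα h
    exact lemma3p13_general Quaternion.finrank_eq_four
      (by rw [OP2.Octonion.finrank_real]; norm_num) α hα fun hpq => h (Or.inl hpq)
  · intro α hα h
    exact lemma3p13_general OP2.Octonion.finrank_complex
      (by rw [OP2.Octonion.finrank_complex]; norm_num) α hα fun hpq => h (Or.inl hpq)
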